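/- Let $d\ge 1$ and $\Sigma=\{x\in\mathbb R^d: 0\le x_i\le 1,\ \sum_i x_i\le 1\}$. Let $C,C'\subset[0,\infty)^d$ be convex bodies (compact convex sets with nonempty interior) such that $\Sigma\subset kC$ and $\Sigma\subset k'C'$ for some positive integers $k,k'$. For $z\in\mathbb C^d$ and $J\in[0,\infty)^d$ write $|z^J|=|z_1|^{j_1}\cdots|z_d|^{j_d}$ (with $0^0=1$), and let $$H_C(z)=\sup_{J\in C}\log|z^J| .$$ Let $L_C$ be the set of plurisubharmonic functions $u:\mathbb C^d\to[-\infty,\infty)$ (the constant $-\infty$ being allowed) such that $u(z)\le H_C(z)+O(1)$ as $|z|\to\infty$, and for $E\subset\mathbb C^d$ let $$V_{C,E}(z)=\sup\{u(z): u\in L_C,\ u\le 0\text{ on }E\}\in[-\infty,\infty].$$ Define $L_{C'}$ and $V_{C',E}$ in the same way. Let $F:\mathbb C^d\to\mathbb C^d$ be a proper polynomial mapping with $$0<\liminf_{|z|\to\infty}\frac{\sup_{J\in C}|F(z)^J|}{\sup_{J'\in C'}|z^{J'}|}\le\limsup_{|z|\to\infty}\frac{\sup_{J\in C}|F(z)^J|}{\sup_{J'\in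 C'}|z^{J'}|}<\infty .$$ Then for every compact set $K\subset\mathbb C^d$ and every $z\in\mathbb C^d$, $$V_{C,K}(F(z))=V_{C',F^{-1}(K)}(z).$$ -/

import Mathlib

open Filter Bornology MeasureTheory

noncomputable section

namespace CExtremal

/-- A convex body in `ℝᵈ`: a compact convex set with nonempty interior. -/
structure IsConvexBody {d : ℕ} (C : Set (Fin d → ℝ)) : Prop where
  isCompact : IsCompact C
  convex : Convex ℝ C
  interior_nonempty : (interior C).Nonempty

/-- The standard simplex `Σ = {x : 0 ≤ xᵢ ≤ 1, ∑ xᵢ ≤ 1}`. -/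
def simplex (d : ℕ) : Set (Fin d → ℝ) :=
  {x | (∀ i, 0 ≤ x i ∧ x i ≤ 1) ∧ ∑ i, x i ≤ 1}

/-- `|z^J| = |z₁|^{j₁} ⋯ |z_d|^{j_d}` for a real exponent vector `J`, with `0^0 = 1`. -/
def absMonomial {d : ℕ} (J : Fin d → ℝ) (z : Fin d → ℂ) : ENNReal :=
  ∏ i, ‖z i‖ₑ ^ (J i)

/-- `sup_{J ∈ C} |z^J|`. -/
def supMonomial {d : ℕ} (C : Set (Fin d → ℝ)) (z : Fin d → ℂ) : ENNReal :=
  ⨆ J ∈ C, absMonomial J z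

/-- The logarithmic indicator function `H_C(z) = sup_{J ∈ C} log |z^J|` (with `log 0 = -∞`). -/
def logIndicator {d : ℕ} (C : Set (Fin d → ℝ)) (z : Fin d → ℂ) : EReal :=
  ⨆ J ∈ C, ENNReal.log (absMonomial J z)

/-- The Lebesgue mean value `(1/2π) ∫₀^{2π} g(e^{iθ}) dθ = (mean of g⁺) - (mean of g⁻)` of an
extended real valued function over the unit circle. -/
def circleMean (g : ℂ → EReal) : EReal :=
  ((laverage (volume.restrict (Set.Ioc 0 (2 * Real.pi)))
      (fun θ : ℝ => (g (Complex.exp (θ * Complex.I))).toENNReal) : ENNReal) : EReal) -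
  ((laverage (volume.restrict (Set.Ioc 0 (2 * Real.pi)))
      (fun θ : ℝ => (-g (Complex.exp (θ * Complex.I))).toENNReal) : ENNReal) : EReal)

/-- Plurisubharmonic functions `ℂᵈ → [-∞, ∞)`: upper semicontinuous, with the sub-mean value
property on every circle of every complex line. The function `-∞` is allowed. -/
structure IsPSH {d : ℕ} (u : (Fin d → ℂ) → EReal) : Prop where
  ne_top : ∀ z, u z ≠ ⊤
  usc : UpperSemicontinuous u
  le_circleMean : ∀ a b : Fin d → ℂ, u a ≤ circleMean (fun ζ => u (a + ζ • b))

/-- The class `L_C` of plurisubharmonic functions `u` on `ℂᵈ` with `u ≤ H_C + O(1)` as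
`|z| → ∞`. -/
def lelongClass {d : ℕ} (C : Set (Fin d → ℝ)) : Set ((Fin d → ℂ) → EReal) :=
  {u | IsPSH u ∧ ∃ c : ℝ, ∀ᶠ z in cobounded (Fin d → ℂ), u z ≤ logIndicator C z + (c : EReal)}

/-- `V_{C,E}(z) = sup {u(z) : u ∈ L_C, u ≤ 0 on E}`, with values in `[-∞, ∞]`. -/
def extremal {d : ℕ} (C : Set (Fin d → ℝ)) (E : Set (Fin d → ℂ)) (z : Fin d → ℂ) : EReal :=
  ⨆ u ∈ {u | u ∈ lelongClass C ∧ ∀ w ∈ E, u w ≤ 0}, u z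

/-- Polynomial mappings `ℂᵈ → ℂᵈ`. -/
def IsPolynomialMap {d : ℕ} (F : (Fin d → ℂ) → (Fin d → ℂ)) : Prop :=
  ∃ P : Fin d → MvPolynomial (Fin d) ℂ, ∀ z i, F z i = MvPolynomial.eval z (P i)

end CExtremal

end

/-! If `u` competes for `V_{C,K}`, then `u ∘ F` competes for `V_{C',F⁻¹(K)}`; conversely, if `v`
competes for the latter, its maximum over the fibres, `w ↦ max {v z : F z = w}`, competes for the
former and dominates `v z` at `F z`. These give the two inequalities. Growth at infinity passes
through the bounds on the quotient of monomial suprema, together with properness.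

The substance is plurisubharmonicity of both functions. A single sub-mean value principle covers
them, with no branched covering theory: for entire `G : ℂ × ℂᵈ → ℂᵈ` whose zero set over the closed
unit disc is suitably bounded, fibrewise values of `v` on `{G = 0}` obey the sub-mean inequality
(`IsPSH.le_circleMean_of_zero_set`). The pullback uses `G = z - F(a + ζb)`, the fibre maximum `G =
F(z) - (a + ζb)`.

By `le_circleMean_of_forall_entire` only majorants `Re h`, with `h` entire, need testing, so the
principle reduces to a maximum principle for `v - Re h` on `{G = 0}`. Its proof replaces `Re h` by
`Re h + N|G|² - (|ζ|² + |z|²)/(N+1)` on the ambient space. As `G` has `d` components in `d + 1`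
variables, `dG` has a kernel vector at every point; on small circles in that direction the mean of
this majorant drops strictly, which rules out an interior maximum of `v` minus it. -/

open Filter MeasureTheory Topology Bornology
open scoped ENNReal NNReal

/-! ### Circle means of extended real functions -/

namespace CExtremal

/-- The normalized Lebesgue measure on `(0, 2π]`. -/
noncomputable def circleMeasure : Measure ℝ :=
  ((volume.restrict (Set.Ioc 0 (2 * Real.pi))) Set.univ)⁻¹ •
    volume.restrict (Set.Ioc 0 (2 * Real.pi))

instance : IsProbabilityMeasure circleMeasure := by
  constructor
  have h : (0 : ℝ) < 2 * Real.pi := by positivity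
  simp only [circleMeasure, Measure.smul_apply, smul_eq_mul]
  refine ENNReal.inv_mul_cancel ?_ ?_
  · simp [Real.pi_pos]
  · simp [ENNReal.mul_eq_top]

theorem circleMean_eq (g : ℂ → EReal) :
    circleMean g = ((∫⁻ θ, (g (Complex.exp (θ * Complex.I))).toENNReal ∂circleMeasure : ENNReal) :
        EReal) - ((∫⁻ θ, (-g (Complex.exp (θ * Complex.I))).toENNReal ∂circleMeasure : ENNReal) :
        EReal) := rfl

theorem integral_circleMeasure (φ : ℂ → ℝ) :
    ∫ θ : ℝ, φ (Complex.exp (θ * Complex.I)) ∂circleMeasure = Real.circleAverage φ 0 1 := by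
  have h : (0 : ℝ) < 2 * Real.pi := by positivity
  rw [Real.circleAverage_def, circleMeasure, integral_smul_measure,
    intervalIntegral.integral_of_le h.le]
  simp [circleMap, Real.pi_pos.le]

theorem integrable_circleMeasure {φ : ℂ → ℝ} (hφ : Continuous φ) :
    Integrable (fun θ : ℝ => φ (Complex.exp (θ * Complex.I))) circleMeasure := by
  have hc : Continuous (fun θ : ℝ => φ (Complex.exp (θ * Complex.I))) := by fun_prop
  refine Integrable.smul_measure ?_ ?_
  · exact (hc.integrableOn_Icc).mono_set Set.Ioc_subset_Icc_self
  · simp [Real.pi_pos]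

theorem circleMean_mono {f g : ℂ → EReal}
    (h : ∀ θ : ℝ, f (Complex.exp (θ * Complex.I)) ≤ g (Complex.exp (θ * Complex.I))) :
    circleMean f ≤ circleMean g := by
  rw [circleMean_eq, circleMean_eq]
  refine EReal.sub_le_sub ?_ ?_
  · exact_mod_cast lintegral_mono fun θ => EReal.toENNReal_le_toENNReal (h θ)
  · exact_mod_cast lintegral_mono fun θ =>
      EReal.toENNReal_le_toENNReal (EReal.neg_le_neg_iff.2 (h θ))

theorem circleMean_coe {φ : ℂ → ℝ} (hφ : Continuous φ) :
    circleMean (fun ζ => (φ ζ : EReal)) = ((Real.circleAverage φ 0 1 : ℝ) : EReal) := by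
  have hi := integrable_circleMeasure hφ
  rw [circleMean_eq, ← integral_circleMeasure,
    integral_eq_lintegral_pos_part_sub_lintegral_neg_part hi, EReal.coe_sub]
  have e (x : ℝ) : (x : EReal).toENNReal = ENNReal.ofReal x := by simp
  have e' (x : ℝ) : (-(x : EReal)).toENNReal = ENNReal.ofReal (-x) := by
    rw [← EReal.coe_neg]; simp
  simp only [e, e']
  have h1 : ∫⁻ θ : ℝ, ENNReal.ofReal (φ (Complex.exp (θ * Complex.I))) ∂circleMeasure ≠ ⊤ :=
    (hi.lintegral_lt_top).ne
  have h2 : ∫⁻ θ : ℝ, ENNReal.ofReal (-φ (Complex.exp (θ * Complex.I))) ∂circleMeasure ≠ ⊤ :=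
    (hi.neg.lintegral_lt_top).ne
  lift (∫⁻ θ : ℝ, ENNReal.ofReal (φ (Complex.exp (θ * Complex.I))) ∂circleMeasure) to ℝ≥0
    using h1 with a
  lift (∫⁻ θ : ℝ, ENNReal.ofReal (-φ (Complex.exp (θ * Complex.I))) ∂circleMeasure) to ℝ≥0
    using h2 with b
  rfl

theorem circleMean_le_circleAverage {f : ℂ → EReal} {φ : ℂ → ℝ} (hφ : Continuous φ)
    (h : ∀ ζ : ℂ, ‖ζ‖ = 1 → f ζ ≤ φ ζ) :
    circleMean f ≤ ((Real.circleAverage φ 0 1 : ℝ) : EReal) := by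
  rw [← circleMean_coe hφ]
  exact circleMean_mono fun θ => h _ (Complex.norm_exp_ofReal_mul_I θ)

theorem toENNReal_add_toENNReal_sub {x : EReal} {M : ℝ} (hM : 0 ≤ M) (hx : x ≤ M) :
    x.toENNReal + ((M : EReal) - x).toENNReal = ENNReal.ofReal M + (-x).toENNReal := by
  induction x with
  | bot => simp
  | top => simp at hx
  | coe x =>
    have hx' : x ≤ M := by exact_mod_cast hx
    rw [← EReal.coe_sub, ← EReal.coe_neg]
    simp only [EReal.toENNReal_of_ne_top (EReal.coe_ne_top _), EReal.toReal_coe]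
    rcases le_total 0 x with h | h
    · rw [← ENNReal.ofReal_add h (by linarith), ENNReal.ofReal_of_nonpos (by linarith : -x ≤ 0)]
      simp
    · rw [← ENNReal.ofReal_add hM (by linarith), ENNReal.ofReal_of_nonpos h, zero_add]
      ring_nf

/-- An upper bound keeps the mean of the positive part finite, so `⊤ - ⊤` never occurs. Integrating
`f⁺ + (M - f) = M + f⁻` expresses the mean through one nonnegative integral, to which monotone
convergence applies. -/
theorem circleMean_eq_sub {f : ℂ → EReal} {M : ℝ} (hM : 0 ≤ M)
    (hm : Measurable fun θ : ℝ => f (Complex.exp (θ * Complex.I)))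
    (h : ∀ θ : ℝ, f (Complex.exp (θ * Complex.I)) ≤ M) :
    circleMean f = (M : EReal) -
      ((∫⁻ θ, ((M : EReal) - f (Complex.exp (θ * Complex.I))).toENNReal ∂circleMeasure : ENNReal) :
        EReal) := by
  have key : ∫⁻ θ, (f (Complex.exp (θ * Complex.I))).toENNReal ∂circleMeasure +
      ∫⁻ θ, ((M : EReal) - f (Complex.exp (θ * Complex.I))).toENNReal ∂circleMeasure =
      ENNReal.ofReal M + ∫⁻ θ, (-f (Complex.exp (θ * Complex.I))).toENNReal ∂circleMeasure := by
    rw [← lintegral_add_left hm.ereal_toENNReal]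
    simp_rw [fun θ : ℝ => toENNReal_add_toENNReal_sub hM (h θ)]
    rw [lintegral_add_left measurable_const]
    simp
  have hA : ∫⁻ θ, (f (Complex.exp (θ * Complex.I))).toENNReal ∂circleMeasure ≤ ENNReal.ofReal M := by
    calc _ ≤ ∫⁻ _θ, ENNReal.ofReal M ∂circleMeasure := by
          refine lintegral_mono fun θ => ?_
          refine (EReal.toENNReal_le_toENNReal (h θ)).trans ?_
          simp
      _ = _ := by simp
  rw [circleMean_eq]
  generalize ∫⁻ θ, (f (Complex.exp (θ * Complex.I))).toENNReal ∂circleMeasure = A at *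
  generalize ∫⁻ θ, ((M : EReal) - f (Complex.exp (θ * Complex.I))).toENNReal ∂circleMeasure = G at *
  generalize ∫⁻ θ, (-f (Complex.exp (θ * Complex.I))).toENNReal ∂circleMeasure = B at *
  have hA' : A ≠ ⊤ := (hA.trans_lt ENNReal.ofReal_lt_top).ne
  lift A to ℝ≥0 using hA'
  induction G using ENNReal.recTopCoe with
  | top =>
    have : B = ⊤ := by simpa using key.symm
    simp [this]
  | coe G =>
    have : B ≠ ⊤ := by
      rintro rfl
      simp at key
    lift B to ℝ≥0 using this
    have key' := congrArg ENNReal.toReal key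
    rw [ENNReal.toReal_add (by finiteness) (by finiteness),
      ENNReal.toReal_add (by finiteness) (by finiteness), ENNReal.toReal_ofReal hM] at key'
    simp only [ENNReal.coe_toReal] at key'
    show ((A : ℝ) : EReal) - ((B : ℝ) : EReal) = (M : EReal) - ((G : ℝ) : EReal)
    rw [← EReal.coe_sub, ← EReal.coe_sub]
    congr 1
    linarith

end CExtremal

/-! ### Testing circle means against real parts of entire functions -/

namespace CExtremal

theorem circleAverage_re_of_differentiable {h : ℂ → ℂ} (hh : Differentiable ℂ h) (r : ℝ) :
    Real.circleAverage (fun ζ => (h ζ).re) 0 r = (h 0).re :=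
  InnerProductSpace.HarmonicOnNhd.circleAverage_eq fun ζ _ => (hh.analyticAt ζ).harmonicAt_re

/-- Continuous functions on the unit circle are uniform limits of real parts of entire functions. -/
theorem exists_entire_re_approx {ψ : ℂ → ℝ} (hψ : Continuous ψ) {η : ℝ} (hη : 0 < η) :
    ∃ h : ℂ → ℂ, Differentiable ℂ h ∧ ∀ ζ : ℂ, ‖ζ‖ = 1 → |(h ζ).re - ψ ζ| < η := by
  have : Fact (0 < 2 * Real.pi) := ⟨by positivity⟩
  let Ψ : C(AddCircle (2 * Real.pi), ℂ) :=
    ⟨fun x => (ψ (AddCircle.toCircle x : ℂ) : ℂ), by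
      have := AddCircle.continuous_toCircle (T := 2 * Real.pi)
      fun_prop⟩
  have hmem : Ψ ∈ (Submodule.span ℂ
      (Set.range (@fourier (2 * Real.pi)))).topologicalClosure := by
    rw [span_fourier_closure_eq_top]; trivial
  obtain ⟨p, hp, hpΨ⟩ := Metric.mem_closure_iff.1 hmem η hη
  have key : ∃ h₁ h₂ : ℂ → ℂ, Differentiable ℂ h₁ ∧ Differentiable ℂ h₂ ∧
      ∀ x, p x = h₁ (AddCircle.toCircle x) +
        (starRingEnd ℂ) (h₂ (AddCircle.toCircle x)) := by
    clear hpΨ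
    induction hp using Submodule.span_induction with
    | mem f hf =>
      obtain ⟨n, rfl⟩ := hf
      obtain ⟨n, rfl | rfl⟩ := n.eq_nat_or_neg
      · refine ⟨fun z => z ^ n, fun _ => 0, by fun_prop, by fun_prop, fun x => ?_⟩
        simp [fourier_apply, AddCircle.toCircle_nsmul]
      · refine ⟨fun _ => 0, fun z => z ^ n, by fun_prop, by fun_prop, fun x => ?_⟩
        simp [fourier_apply, AddCircle.toCircle_nsmul, AddCircle.toCircle_neg,
          ← Circle.coe_inv_eq_conj]
    | zero => exact ⟨fun _ => 0, fun _ => 0, by fun_prop, by fun_prop, by simp⟩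
    | add f g _ _ hf hg =>
      obtain ⟨a, b, ha, hb, h⟩ := hf
      obtain ⟨a', b', ha', hb', h'⟩ := hg
      refine ⟨fun z => a z + a' z, fun z => b z + b' z, by fun_prop, by fun_prop, fun x => ?_⟩
      simp [h, h']; ring
    | smul c f _ hf =>
      obtain ⟨a, b, ha, hb, h⟩ := hf
      refine ⟨fun z => c * a z, fun z => (starRingEnd ℂ) c * b z, by fun_prop, by fun_prop,
        fun x => ?_⟩
      simp [h]; ring
  obtain ⟨h₁, h₂, hh₁, hh₂, h⟩ := key
  -- A trigonometric polynomial is `h₁ + conj h₂` on the circle, and conjugation does not change the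
  -- real part.
  refine ⟨fun z => h₁ z + h₂ z, by fun_prop, fun ζ hζ => ?_⟩
  obtain ⟨x, hx⟩ : ∃ x : AddCircle (2 * Real.pi), (AddCircle.toCircle x : ℂ) = ζ := by
    refine ⟨(ζ.arg : ℝ), ?_⟩
    have h2 := Complex.norm_mul_exp_arg_mul_I ζ
    rw [hζ, Complex.ofReal_one, one_mul] at h2
    simpa [AddCircle.toCircle_apply_mk, Circle.coe_exp, Real.pi_ne_zero] using h2
  have h1 := (ContinuousMap.dist_apply_le_dist (f := Ψ) (g := p) x).trans_lt hpΨ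
  rw [dist_comm, dist_eq_norm] at h1
  refine lt_of_le_of_lt ?_ h1
  refine le_trans (le_of_eq ?_) (Complex.abs_re_le_norm _)
  simp [h, hx, Ψ]

/-- The inf-convolution of `min g n` with `n` times the distance. -/
noncomputable def infConv {X : Type*} [PseudoEMetricSpace X] (g : X → ℝ≥0∞) (n : ℕ) (x : X) : ℝ≥0∞ :=
  ⨅ y, (min (g y) n + n * edist x y)

section infConv
variable {X : Type*} [PseudoEMetricSpace X] {g : X → ℝ≥0∞}

theorem infConv_le_min (n : ℕ) (x : X) : infConv g n x ≤ min (g x) n :=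
  (iInf_le _ x).trans (by simp)

theorem infConv_mono : Monotone (infConv g) := by
  intro m n hmn x
  refine iInf_mono fun y => ?_
  have : (m : ℝ≥0∞) ≤ n := by exact_mod_cast hmn
  gcongr

theorem infConv_le_add (n : ℕ) (x y : X) : infConv g n x ≤ infConv g n y + n * edist x y := by
  unfold infConv
  rw [ENNReal.iInf_add]
  refine le_iInf fun w => (iInf_le _ w).trans ?_
  rw [add_assoc, ← mul_add, add_comm (edist y w)]
  gcongr
  exact edist_triangle _ _ _

theorem continuous_infConv (n : ℕ) : Continuous (infConv g n) :=
  continuous_of_le_add_edist n (by simp) (infConv_le_add n)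

theorem iSup_infConv (hg : LowerSemicontinuous g) (x : X) : ⨆ n, infConv g n x = g x := by
  refine le_antisymm (iSup_le fun n => (infConv_le_min n x).trans (min_le_left _ _)) ?_
  refine le_of_forall_lt fun c hc => ?_
  obtain ⟨c', hcc', hc'⟩ := exists_between hc
  have hc't : c' ≠ ⊤ := (hc'.trans_le le_top).ne
  obtain ⟨δ, hδ, hball⟩ := EMetric.mem_nhds_iff.1 (lowerSemicontinuous_iff.1 hg x c' hc')
  -- `n₁` makes the truncation harmless on the ball where `g > c'`; `n₂` makes the distance term
  -- exceed `c'` off that ball.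
  obtain ⟨n₁, hn₁⟩ := ENNReal.exists_nat_gt hc't
  obtain ⟨n₂, hn₂⟩ := ENNReal.exists_nat_mul_gt hδ.ne' hc't
  refine hcc'.trans_le (le_trans ?_ (le_iSup _ (max n₁ n₂)))
  refine le_iInf fun y => ?_
  have h1 : (n₁ : ℝ≥0∞) ≤ (max n₁ n₂ : ℕ) := by exact_mod_cast le_max_left _ _
  have h2 : (n₂ : ℝ≥0∞) ≤ (max n₁ n₂ : ℕ) := by exact_mod_cast le_max_right _ _
  by_cases hy : y ∈ Metric.eball x δ
  · exact (le_min (hball hy).le (hn₁.le.trans h1)).trans le_self_add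
  · refine le_trans ?_ le_add_self
    rw [Metric.mem_eball, not_lt, edist_comm] at hy
    exact hn₂.le.trans (by gcongr)

end infConv

/-- An upper semicontinuous function satisfies the sub-mean value inequality on the unit circle
as soon as it does so for all its majorants that are real parts of entire functions. -/
theorem le_circleMean_of_forall_entire {f : ℂ → EReal} (hf : UpperSemicontinuous f)
    (htop : ∀ ζ, f ζ ≠ ⊤) {c : EReal}
    (H : ∀ h : ℂ → ℂ, Differentiable ℂ h → (∀ ζ : ℂ, ‖ζ‖ = 1 → f ζ < ((h ζ).re : EReal)) →
      c ≤ ((h 0).re : EReal)) :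
    c ≤ circleMean f := by
  obtain ⟨M, hM, hfM⟩ : ∃ M : ℝ, 0 ≤ M ∧ ∀ ζ : ℂ, ‖ζ‖ = 1 → f ζ ≤ M := by
    obtain ⟨x, hx, hmax⟩ := (hf.upperSemicontinuousOn (Metric.sphere (0 : ℂ) 1)).exists_isMaxOn
      ⟨1, by simp⟩ (isCompact_sphere _ _)
    refine ⟨max 0 (f x).toReal, le_max_left _ _, fun ζ hζ => ?_⟩
    refine (hmax (by simpa using hζ : ζ ∈ Metric.sphere (0 : ℂ) 1)).trans ?_
    refine (EReal.le_coe_toReal (htop x)).trans ?_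
    exact_mod_cast le_max_right _ _
  set g : ℂ → ℝ≥0∞ := fun ζ => ((M : EReal) - f ζ).toENNReal with hg
  have hgl : LowerSemicontinuous g := by
    refine Continuous.comp_upperSemicontinuous_antitone
      (g := fun x : EReal => ((M : EReal) - x).toENNReal) ?_ hf ?_
    · refine EReal.continuous_toENNReal.comp (continuous_iff_continuousAt.2 fun x => ?_)
      have h1 : ContinuousAt (fun p : EReal × EReal => p.1 + p.2) ((M : EReal), -x) :=
        EReal.continuousAt_add (by simp) (by simp)
      have h2 : ContinuousAt (fun x : EReal => ((M : EReal), -x)) x := by fun_prop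
      exact ContinuousAt.comp (f := fun x : EReal => ((M : EReal), -x)) h1 h2
    · intro x y hxy
      exact EReal.toENNReal_le_toENNReal (EReal.sub_le_sub le_rfl hxy)
  have hcm : Continuous fun θ : ℝ => Complex.exp (θ * Complex.I) := by fun_prop
  rw [circleMean_eq_sub hM (hf.measurable.comp hcm.measurable)
    fun θ => hfM _ (Complex.norm_exp_ofReal_mul_I θ)]
  change c ≤ (M : EReal) - ((∫⁻ θ : ℝ, g (Complex.exp (θ * Complex.I)) ∂circleMeasure :) : EReal)
  have hsup : ∫⁻ θ : ℝ, g (Complex.exp (θ * Complex.I)) ∂circleMeasure =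
      ⨆ n, ∫⁻ θ : ℝ, infConv g n (Complex.exp (θ * Complex.I)) ∂circleMeasure := by
    rw [← lintegral_iSup (f := fun n (θ : ℝ) => infConv g n (Complex.exp (θ * Complex.I)))
      (fun n => ((continuous_infConv n).comp hcm).measurable) fun m n hmn θ => infConv_mono hmn _]
    simp_rw [iSup_infConv hgl]
  by_contra! hlt
  obtain ⟨c', h1, h2⟩ := EReal.lt_iff_exists_real_btwn.1 hlt
  have hfin (n : ℕ) (x : ℂ) : infConv g n x ≠ ⊤ :=
    ((infConv_le_min n x).trans (min_le_right _ _)).trans_lt (by simp) |>.ne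
  have hcont (n : ℕ) : Continuous fun ζ => (infConv g n ζ).toReal :=
    ENNReal.continuousOn_toReal.comp_continuous (continuous_infConv n) (hfin n)
  -- Were the mean of `f` below `c'`, the mean of `g = M - f` would exceed `M - c'`; by monotone
  -- convergence so does that of some continuous `infConv g n ≤ g`.
  obtain ⟨n, hn⟩ : ∃ n, M - c' < Real.circleAverage (fun ζ => (infConv g n ζ).toReal) 0 1 := by
    simp_rw [← integral_circleMeasure]
    rcases lt_or_ge (M - c') 0 with hneg | hpos
    · exact ⟨0, hneg.trans_le (integral_nonneg fun _ => ENNReal.toReal_nonneg)⟩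
    have h3 : ENNReal.ofReal (M - c') <
        ∫⁻ θ : ℝ, g (Complex.exp (θ * Complex.I)) ∂circleMeasure := by
      generalize ∫⁻ θ : ℝ, g (Complex.exp (θ * Complex.I)) ∂circleMeasure = I at h1
      induction I using ENNReal.recTopCoe with
      | top => simp
      | coe I =>
        change (M : EReal) - ((I : ℝ) : EReal) < c' at h1
        rw [← EReal.coe_sub, EReal.coe_lt_coe_iff] at h1
        rw [ENNReal.ofReal_lt_coe_iff (by linarith)]
        linarith
    rw [hsup] at h3
    obtain ⟨n, hn⟩ := lt_iSup_iff.1 h3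
    refine ⟨n, ?_⟩
    rw [show ∫⁻ θ : ℝ, infConv g n (Complex.exp (θ * Complex.I)) ∂circleMeasure =
        ENNReal.ofReal (∫ θ : ℝ, (infConv g n (Complex.exp (θ * Complex.I))).toReal
          ∂circleMeasure) by
      rw [ofReal_integral_eq_lintegral_ofReal (integrable_circleMeasure (hcont n))
        (Eventually.of_forall fun θ => ENNReal.toReal_nonneg)]
      simp [ENNReal.ofReal_toReal, hfin]] at hn
    exact (ENNReal.ofReal_lt_ofReal_iff'.1 hn).1
  set φ : ℂ → ℝ := fun ζ => (infConv g n ζ).toReal with hφ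
  have hφc : Continuous φ := hcont n
  obtain ⟨η, hη, hηlt⟩ : ∃ η > 0, M - c' + 2 * η < Real.circleAverage φ 0 1 :=
    ⟨(Real.circleAverage φ 0 1 - (M - c')) / 4, by linarith, by linarith⟩
  -- Aiming at `M + η - φ` with error below `η` places `Re h` strictly between `M - φ ≥ f` and `M +
  -- 2η - φ` on the circle.
  obtain ⟨h, hh, happ⟩ := exists_entire_re_approx
    (ψ := fun ζ => M + η - φ ζ) (by fun_prop) hη
  have h5 : c ≤ ((h 0).re : EReal) := by
    refine H h hh fun ζ hζ => ?_
    have h6 := (abs_lt.1 (happ ζ hζ)).1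
    have h7 : f ζ ≤ ((M - φ ζ : ℝ) : EReal) := by
      have h8 : infConv g n ζ ≤ g ζ := (infConv_le_min n ζ).trans (min_le_left _ _)
      have h9 := hfM ζ hζ
      rw [← ENNReal.ofReal_toReal (hfin n ζ)] at h8
      change ENNReal.ofReal (φ ζ) ≤ ((M : EReal) - f ζ).toENNReal at h8
      have hfz := htop ζ
      generalize f ζ = y at *
      induction y with
      | bot => simp
      | top => simp at hfz
      | coe y =>
        rw [← EReal.coe_sub, EReal.real_coe_toENNReal, ENNReal.ofReal_le_ofReal_iff] at h8
        · exact_mod_cast (by linarith : y ≤ M - φ ζ)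
        · have : y ≤ M := by exact_mod_cast h9
          linarith
    refine h7.trans_lt ?_
    exact_mod_cast (by linarith : M - φ ζ < (h ζ).re)
  have h10 : (h 0).re ≤ Real.circleAverage (fun ζ => M + 2 * η - φ ζ) 0 1 := by
    rw [← circleAverage_re_of_differentiable hh 1]
    have hhc := hh.continuous
    refine Real.circleAverage_mono (ContinuousOn.circleIntegrable' (by fun_prop))
      (ContinuousOn.circleIntegrable' (by fun_prop)) fun ζ hζ => ?_
    have := (abs_lt.1 (happ ζ (by simpa using hζ))).2
    linarith
  rw [Real.circleAverage_fun_sub (circleIntegrable_const _ _ _) hφc.continuousOn.circleIntegrable',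
    Real.circleAverage_const] at h10
  have h11 : (c' : EReal) < ((h 0).re : EReal) := h2.trans_le h5
  have h12 : c' < (h 0).re := by exact_mod_cast h11
  linarith

end CExtremal

/-! ### The penalized majorant and its small circle averages -/

namespace CExtremal

theorem exists_eq_add_sq_mul {f : ℂ → ℂ} (hf : Differentiable ℂ f) (h0 : deriv f 0 = 0) :
    ∃ g : ℂ → ℂ, Differentiable ℂ g ∧ ∀ t, f t = f 0 + t ^ 2 * g t := by
  have hd {f : ℂ → ℂ} (hf : Differentiable ℂ f) : Differentiable ℂ (dslope f 0) := by
    rw [← differentiableOn_univ] at hf ⊢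
    exact (Complex.differentiableOn_dslope univ_mem).2 hf
  refine ⟨dslope (dslope f 0) 0, hd (hd hf), fun t => ?_⟩
  have h1 := sub_smul_dslope f 0 t
  have h2 := sub_smul_dslope (dslope f 0) 0 t
  simp only [dslope_same, h0, sub_zero, smul_eq_mul] at h1 h2
  rw [pow_two, mul_assoc, h2, h1]
  ring

/-- Writing `f = c + t² g`, the cross term of `|f|²` is the real part of an entire function
vanishing at `0`, so it averages to zero; only `r⁴|g|²` remains. -/
theorem circleAverage_norm_sq_le {f : ℂ → ℂ} (hf : Differentiable ℂ f) (h0 : deriv f 0 = 0) :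
    ∃ A : ℝ, ∀ r : ℝ, 0 ≤ r → r ≤ 1 →
      Real.circleAverage (fun t => ‖f t‖ ^ 2) 0 r ≤ ‖f 0‖ ^ 2 + A * r ^ 4 := by
  obtain ⟨g, hg, hfg⟩ := exists_eq_add_sq_mul hf h0
  have hgc := hg.continuous
  have hfc := hf.continuous
  obtain ⟨B, hB⟩ := (isCompact_closedBall (0 : ℂ) 1).exists_bound_of_continuousOn hgc.continuousOn
  refine ⟨B ^ 2, fun r hr hr1 => ?_⟩
  set c := f 0 with hc
  have hq : Differentiable ℂ fun t => 2 * (starRingEnd ℂ c * (t ^ 2 * g t)) := by fun_prop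
  calc Real.circleAverage (fun t => ‖f t‖ ^ 2) 0 r
      ≤ Real.circleAverage (fun t => (‖c‖ ^ 2 + B ^ 2 * r ^ 4) +
          (2 * (starRingEnd ℂ c * (t ^ 2 * g t))).re) 0 r := by
        refine Real.circleAverage_mono (ContinuousOn.circleIntegrable' (by fun_prop))
          (ContinuousOn.circleIntegrable' (by fun_prop)) fun t ht => ?_
        have ht' : ‖t‖ = r := by simpa [abs_of_nonneg hr] using ht
        have hb := hB t (by simp [ht', hr1])
        have e : ‖f t‖ ^ 2 = ‖c‖ ^ 2 + (2 * (starRingEnd ℂ c * (t ^ 2 * g t))).re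
            + r ^ 4 * ‖g t‖ ^ 2 := by
          rw [hfg t, ← ht', show ‖t‖ ^ 4 * ‖g t‖ ^ 2 = ‖t ^ 2 * g t‖ ^ 2 by
            rw [norm_mul, norm_pow]; ring]
          simp only [← Complex.normSq_eq_norm_sq, Complex.normSq_add, Complex.mul_re,
            Complex.conj_re, Complex.conj_im, Complex.re_ofNat, Complex.im_ofNat]
          ring
        have hb2 : ‖g t‖ ^ 2 ≤ B ^ 2 := by gcongr
        have : r ^ 4 * ‖g t‖ ^ 2 ≤ r ^ 4 * B ^ 2 := by gcongr
        rw [e]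
        linarith
    _ = ‖c‖ ^ 2 + B ^ 2 * r ^ 4 := by
        have hqc := hq.continuous
        rw [Real.circleAverage_fun_add (circleIntegrable_const _ _ _)
          (ContinuousOn.circleIntegrable' (by fun_prop)), Real.circleAverage_const,
          circleAverage_re_of_differentiable hq]
        simp

theorem circleAverage_norm_add_mul_sq (a b : ℂ) {r : ℝ} (hr : 0 ≤ r) :
    Real.circleAverage (fun t => ‖a + t * b‖ ^ 2) 0 r = ‖a‖ ^ 2 + r ^ 2 * ‖b‖ ^ 2 := by
  have hq : Differentiable ℂ fun t => 2 * (starRingEnd ℂ a * (t * b)) := by fun_prop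
  have hqc := hq.continuous
  calc Real.circleAverage (fun t => ‖a + t * b‖ ^ 2) 0 r
      = Real.circleAverage (fun t => (‖a‖ ^ 2 + r ^ 2 * ‖b‖ ^ 2) +
          (2 * (starRingEnd ℂ a * (t * b))).re) 0 r := by
        refine Real.circleAverage_congr_sphere fun t ht => ?_
        have ht' : ‖t‖ = r := by simpa [abs_of_nonneg hr] using ht
        have e : r ^ 2 * ‖b‖ ^ 2 = ‖t * b‖ ^ 2 := by rw [norm_mul, ht']; ring
        simp only [e]
        simp only [← Complex.normSq_eq_norm_sq, Complex.normSq_add, Complex.mul_re,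
            Complex.conj_re, Complex.conj_im, Complex.re_ofNat, Complex.im_ofNat]
        ring
    _ = _ := by
        rw [Real.circleAverage_fun_add (circleIntegrable_const _ _ _)
          (ContinuousOn.circleIntegrable' (by fun_prop)), Real.circleAverage_const,
          circleAverage_re_of_differentiable hq]
        simp

variable {d : ℕ}

/-- The square of the Euclidean norm on `ℂᵈ`. -/
noncomputable def sqNorm (z : Fin d → ℂ) : ℝ := ∑ i, ‖z i‖ ^ 2

theorem continuous_sqNorm : Continuous (sqNorm (d := d)) := by
  unfold sqNorm; fun_prop

theorem sqNorm_nonneg (z : Fin d → ℂ) : 0 ≤ sqNorm z :=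
  Finset.sum_nonneg fun _ _ => by positivity

theorem sqNorm_pos {z : Fin d → ℂ} (hz : z ≠ 0) : 0 < sqNorm z := by
  obtain ⟨i, hi⟩ := Function.ne_iff.1 hz
  exact Finset.sum_pos' (fun _ _ => by positivity) ⟨i, Finset.mem_univ _, by
    have : 0 < ‖z i‖ := norm_pos_iff.2 hi
    positivity⟩

theorem circleAverage_sqNorm_le {f : ℂ → Fin d → ℂ} (hf : Differentiable ℂ f)
    (h0 : deriv f 0 = 0) :
    ∃ A : ℝ, ∀ r : ℝ, 0 ≤ r → r ≤ 1 →
      Real.circleAverage (fun t => sqNorm (f t)) 0 r ≤ sqNorm (f 0) + A * r ^ 4 := by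
  have hfi (i) : Differentiable ℂ fun t => f t i := by fun_prop
  have h0i (i) : deriv (fun t => f t i) 0 = 0 := by
    rw [deriv_pi fun i => (hfi i) 0] at h0
    exact congrFun h0 i
  choose A hA using fun i => circleAverage_norm_sq_le (hfi i) (h0i i)
  refine ⟨∑ i, A i, fun r hr hr1 => ?_⟩
  unfold sqNorm
  rw [Real.circleAverage_fun_sum, Finset.sum_mul, ← Finset.sum_add_distrib]
  · exact Finset.sum_le_sum fun i _ => hA i r hr hr1
  · intro i _
    have := (hfi i).continuous
    exact ContinuousOn.circleIntegrable' (by fun_prop)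

theorem circleAverage_sqNorm_add_smul (a b : Fin d → ℂ) {r : ℝ} (hr : 0 ≤ r) :
    Real.circleAverage (fun t : ℂ => sqNorm (a + t • b)) 0 r = sqNorm a + r ^ 2 * sqNorm b := by
  unfold sqNorm
  rw [Real.circleAverage_fun_sum, Finset.mul_sum, ← Finset.sum_add_distrib]
  · exact Finset.sum_congr rfl fun i _ => circleAverage_norm_add_mul_sq _ _ hr
  · intro i _
    exact ContinuousOn.circleIntegrable' (by fun_prop)

/-- The penalized majorant `Re h(ζ) + N |G(ζ, z)|² - (|ζ|² + |z|²) / (N + 1)`. -/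
noncomputable def penalty (h : ℂ → ℂ) (G : ℂ × (Fin d → ℂ) → Fin d → ℂ) (N : ℕ) (x : ℂ × (Fin d → ℂ)) : ℝ :=
  (h x.1).re + N * sqNorm (G x) - (‖x.1‖ ^ 2 + sqNorm x.2) / (N + 1)

section penalty
variable {h : ℂ → ℂ} {G : ℂ × (Fin d → ℂ) → Fin d → ℂ}

theorem continuous_penalty (hh : Continuous h) (hG : Continuous G) (N : ℕ) :
    Continuous (penalty h G N) := by
  have := continuous_sqNorm (d := d)
  unfold penalty
  fun_prop

theorem penalty_mono : Monotone (penalty h G) := by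
  intro m n hmn x
  have h1 := sqNorm_nonneg (G x)
  have h2 := sqNorm_nonneg x.2
  have h3 : (m : ℝ) ≤ n := by exact_mod_cast hmn
  unfold penalty
  gcongr

theorem penalty_le_of_eq_zero {x : ℂ × (Fin d → ℂ)} (hx : G x = 0) (N : ℕ) :
    penalty h G N x ≤ (h x.1).re := by
  have h2 := sqNorm_nonneg x.2
  have : 0 ≤ (‖x.1‖ ^ 2 + sqNorm x.2) / (N + 1) := by positivity
  simp only [penalty, hx, sqNorm, Pi.zero_apply, norm_zero]
  simp only [sqNorm] at this
  simp
  linarith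

/-- At every point the penalized majorant is strictly superharmonic along some complex line. -/
theorem exists_circleAverage_penalty_lt (hh : Differentiable ℂ h) (hG : Differentiable ℂ G)
    (N : ℕ) (x : ℂ × (Fin d → ℂ)) {δ : ℝ} (hδ : 0 < δ) :
    ∃ y : ℂ × (Fin d → ℂ), ‖y‖ < δ ∧
      Real.circleAverage (fun t => penalty h G N (x + t • y)) 0 1 < penalty h G N x := by
  -- The derivative maps dimension `d + 1` to dimension `d`, hence has a kernel.
  obtain ⟨y, hy, hy0⟩ : ∃ y : ℂ × (Fin d → ℂ), fderiv ℂ G x y = 0 ∧ y ≠ 0 := by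
    have : LinearMap.ker (fderiv ℂ G x : (ℂ × (Fin d → ℂ)) →ₗ[ℂ] (Fin d → ℂ)) ≠ ⊥ :=
      LinearMap.ker_ne_bot_of_finrank_lt (by simp)
    obtain ⟨y, hy, hy0⟩ := Submodule.exists_mem_ne_zero_of_ne_bot this
    exact ⟨y, by simpa using hy, hy0⟩
  have hl : Differentiable ℂ fun t : ℂ => x + t • y := by fun_prop
  have hGl : Differentiable ℂ fun t : ℂ => G (x + t • y) := hG.comp hl
  have hd : deriv (fun t : ℂ => G (x + t • y)) 0 = 0 := by
    have h1 : HasDerivAt (fun t : ℂ => x + t • y) y 0 := by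
      simpa using ((hasDerivAt_id (0 : ℂ)).smul_const y).const_add x
    have h2 : HasFDerivAt G (fderiv ℂ G x) (x + (0 : ℂ) • y) := by
      simpa using (hG x).hasFDerivAt
    exact (h2.comp_hasDerivAt (0 : ℂ) h1).deriv.trans hy
  obtain ⟨A, hA⟩ := circleAverage_sqNorm_le hGl hd
  have hyp : 0 < ‖y.1‖ ^ 2 + sqNorm y.2 := by
    by_cases h1 : y.1 = 0
    · have h2 : y.2 ≠ 0 := fun h2 => hy0 (Prod.ext h1 h2)
      have := sqNorm_pos h2
      positivity
    · have h3 := sqNorm_nonneg y.2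
      have : 0 < ‖y.1‖ := norm_pos_iff.2 h1
      positivity
  set Y := ‖y.1‖ ^ 2 + sqNorm y.2 with hY
  -- The gain `N A r⁴` from `N|G|²` must be beaten by the loss `r² Y / (N + 1)` from the quadratic
  -- term; the condition is divided by `r²`.
  obtain ⟨r, hr0, hr1, hrδ, hrA⟩ : ∃ r : ℝ, 0 < r ∧ r ≤ 1 ∧ r * ‖y‖ < δ ∧
      N * A * r ^ 2 < Y / (N + 1) := by
    have e1 : ∀ᶠ r : ℝ in 𝓝[>] 0, r * ‖y‖ < δ := by
      have : Tendsto (fun r : ℝ => r * ‖y‖) (𝓝 0) (𝓝 (0 * ‖y‖)) :=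
        (by fun_prop : Continuous fun r : ℝ => r * ‖y‖).tendsto 0
      rw [zero_mul] at this
      exact (this.mono_left nhdsWithin_le_nhds).eventually_lt_const hδ
    have e2 : ∀ᶠ r : ℝ in 𝓝[>] 0, N * A * r ^ 2 < Y / (N + 1) := by
      have : Tendsto (fun r : ℝ => N * A * r ^ 2) (𝓝 0) (𝓝 (N * A * 0 ^ 2)) :=
        (by fun_prop : Continuous fun r : ℝ => N * A * r ^ 2).tendsto 0
      rw [zero_pow two_ne_zero, mul_zero] at this
      exact (this.mono_left nhdsWithin_le_nhds).eventually_lt_const (by positivity)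
    have e3 : ∀ᶠ r : ℝ in 𝓝[>] 0, 0 < r := self_mem_nhdsWithin
    have e4 : ∀ᶠ r : ℝ in 𝓝[>] 0, r ≤ 1 :=
      (eventually_le_nhds one_pos).filter_mono nhdsWithin_le_nhds
    obtain ⟨r, h1, h2, h3, h4⟩ := (e1.and (e2.and (e3.and e4))).exists
    exact ⟨r, h3, h4, h1, h2⟩
  refine ⟨(r : ℂ) • y, by simpa [norm_smul, abs_of_pos hr0] using hrδ, ?_⟩
  have hscale : Real.circleAverage (fun t => penalty h G N (x + t • ((r : ℂ) • y))) 0 1 =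
      Real.circleAverage (fun t => penalty h G N (x + t • y)) 0 r := by
    rw [Real.circleAverage_eq_circleAverage_zero_one (R := r)]
    congr 1
    ext t
    rw [smul_smul, mul_comm t, add_zero]
  rw [hscale]
  have hsq := continuous_sqNorm (d := d)
  have hhc := hh.continuous
  have hGc := hG.continuous
  have hr : Real.circleAverage (fun t => penalty h G N (x + t • y)) 0 r =
      (h x.1).re + N * Real.circleAverage (fun t => sqNorm (G (x + t • y))) 0 r -
        (‖x.1‖ ^ 2 + sqNorm x.2 + r ^ 2 * Y) / (N + 1) := by
    have hre : Real.circleAverage (fun t : ℂ => (h (x.1 + t * y.1)).re) 0 r = (h x.1).re := by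
      have : Differentiable ℂ fun t : ℂ => h (x.1 + t * y.1) := by fun_prop
      simpa using circleAverage_re_of_differentiable this r
    have h1 : Real.circleAverage (fun t : ℂ => ‖x.1 + t * y.1‖ ^ 2 + sqNorm (x.2 + t • y.2)) 0 r
        = ‖x.1‖ ^ 2 + sqNorm x.2 + r ^ 2 * Y := by
      rw [Real.circleAverage_fun_add (ContinuousOn.circleIntegrable' (by fun_prop))
        (ContinuousOn.circleIntegrable' (by fun_prop)), circleAverage_norm_add_mul_sq _ _ hr0.le,
        circleAverage_sqNorm_add_smul _ _ hr0.le]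
      ring
    have h2 : (fun t : ℂ => penalty h G N (x + t • y)) = fun t : ℂ =>
        (h (x.1 + t * y.1)).re + (N : ℝ) • sqNorm (G (x + t • y)) -
          ((N : ℝ) + 1)⁻¹ • (‖x.1 + t * y.1‖ ^ 2 + sqNorm (x.2 + t • y.2)) := by
      ext t
      simp [penalty, div_eq_inv_mul]
    rw [h2, Real.circleAverage_fun_sub (ContinuousOn.circleIntegrable' (by fun_prop))
      (ContinuousOn.circleIntegrable' (by fun_prop)),
      Real.circleAverage_fun_add (ContinuousOn.circleIntegrable' (by fun_prop))
      (ContinuousOn.circleIntegrable' (by fun_prop)), Real.circleAverage_fun_smul,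
      Real.circleAverage_fun_smul, hre, h1]
    simp [div_eq_inv_mul]
  rw [hr]
  have hAr := hA r hr0.le hr1
  simp only [zero_smul, add_zero] at hAr
  have h5 : N * Real.circleAverage (fun t => sqNorm (G (x + t • y))) 0 r ≤
      N * (sqNorm (G x) + A * r ^ 4) := by gcongr
  have h6 : r ^ 2 * (N * A * r ^ 2) < r ^ 2 * (Y / (N + 1)) := by gcongr
  unfold penalty
  rw [add_div (‖x.1‖ ^ 2 + sqNorm x.2), mul_div_assoc]
  linarith

end penalty

end CExtremal

/-! ### The maximum principle on the zero set -/

namespace CExtremal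

theorem isOpen_lt_coe {X : Type*} [TopologicalSpace X] {v : X → EReal}
    (hv : UpperSemicontinuous v) {k : X → ℝ} (hk : Continuous k) :
    IsOpen {x | v x < (k x : EReal)} := by
  have : {x | v x < (k x : EReal)} = ⋃ c : ℝ, {x | v x < (c : EReal)} ∩ {x | c < k x} := by
    ext x
    simp only [Set.mem_ofPred_eq, Set.mem_iUnion, Set.mem_inter_iff]
    constructor
    · intro h
      obtain ⟨c, h1, h2⟩ := EReal.lt_iff_exists_real_btwn.1 h
      exact ⟨c, h1, by exact_mod_cast h2⟩
    · rintro ⟨c, h1, h2⟩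
      exact h1.trans (by exact_mod_cast h2)
  rw [this]
  exact isOpen_iUnion fun c => (hv.isOpen_preimage c).inter (isOpen_lt continuous_const hk)

variable {d : ℕ} {v : (Fin d → ℂ) → EReal}

theorem upperSemicontinuous_sub_coe {X : Type*} [TopologicalSpace X] {v : X → EReal}
    (hv : UpperSemicontinuous v) {k : X → ℝ} (hk : Continuous k) :
    UpperSemicontinuous fun x => v x - (k x : EReal) := by
  simp_rw [sub_eq_add_neg, ← EReal.coe_neg]
  refine UpperSemicontinuous.add' hv ?_ fun x =>
    EReal.continuousAt_add (Or.inr (EReal.coe_ne_bot _)) (Or.inr (EReal.coe_ne_top _))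
  exact (continuous_coe_real_ereal.comp hk.neg).upperSemicontinuous

/-- Sub-mean value property along a family of zero sets: if `v` is plurisubharmonic, the zero set
of the entire map `G` over the closed unit disc is locally bounded, and `v(z) < Re h(ζ)` on the
part of this zero set over the unit circle, then `v(z) ≤ Re h(0)` on the part over the origin. -/
theorem IsPSH.le_re_of_zero_set (hv : IsPSH v) {G : ℂ × (Fin d → ℂ) → Fin d → ℂ}
    (hG : Differentiable ℂ G) {R : ℝ} (hR : ∀ x, ‖x.1‖ ≤ 1 → ‖G x‖ ≤ 1 → ‖x.2‖ ≤ R)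
    {h : ℂ → ℂ} (hh : Differentiable ℂ h)
    (hlt : ∀ x, ‖x.1‖ = 1 → G x = 0 → v x.2 < ((h x.1).re : EReal))
    {z₀ : Fin d → ℂ} (hz₀ : G (0, z₀) = 0) : v z₀ ≤ ((h 0).re : EReal) := by
  have hk (N) : Continuous (penalty h G N) := continuous_penalty hh.continuous hG.continuous N
  have hv2 : UpperSemicontinuous fun x : ℂ × (Fin d → ℂ) => v x.2 :=
    hv.usc.comp continuous_snd
  -- Radius `R + 1` keeps zeros of `G` off the lateral boundary `‖z‖ = R + 1`.
  set S : Set (ℂ × (Fin d → ℂ)) := Metric.closedBall 0 1 ×ˢ Metric.closedBall 0 (R + 1) with hS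
  have hScomp : IsCompact S := (isCompact_closedBall _ _).prod (isCompact_closedBall _ _)
  have hmemS (x) : x ∈ S ↔ ‖x.1‖ ≤ 1 ∧ ‖x.2‖ ≤ R + 1 := by simp [hS]
  set B : Set (ℂ × (Fin d → ℂ)) := S ∩ {x | ‖x.1‖ = 1 ∨ ‖x.2‖ = R + 1} with hB
  have hBcomp : IsCompact B := by
    refine hScomp.inter_right (IsClosed.union (isClosed_eq ?_ ?_) (isClosed_eq ?_ ?_)) <;> fun_prop
  -- Dini argument: the majorants increase with `N`, to `Re h > v` where `G = 0` and to `+∞`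
  -- elsewhere on `B`, so by compactness one `N` works on all of `B`.
  obtain ⟨N, hN⟩ : ∃ N, B ⊆ {x | v x.2 < (penalty h G N x : EReal)} := by
    refine hBcomp.elim_directed_cover _ (fun N => isOpen_lt_coe hv2 (hk N)) ?_ ?_
    · rintro x ⟨hxS, hx⟩
      rw [Set.mem_iUnion]
      by_cases hGx : G x = 0
      · have hx1 : ‖x.1‖ = 1 := by
          refine hx.resolve_right fun h2 => ?_
          have := hR x ((hmemS x).1 hxS).1 (by simp [hGx])
          linarith
        obtain ⟨c, hc1, hc2⟩ := EReal.lt_iff_exists_real_btwn.1 (hlt x hx1 hGx)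
        have hc2' : c < (h x.1).re := by exact_mod_cast hc2
        have ht : Tendsto (fun N : ℕ => penalty h G N x) atTop (𝓝 (h x.1).re) := by
          have h0 : sqNorm (0 : Fin d → ℂ) = 0 := by simp [sqNorm]
          simp only [penalty, hGx, h0, mul_zero, add_zero, div_eq_mul_one_div (‖x.1‖ ^ 2 + _)]
          simpa only [mul_zero, sub_zero] using tendsto_const_nhds.sub
            ((tendsto_one_div_add_atTop_nhds_zero_nat (𝕜 := ℝ)).const_mul (‖x.1‖ ^ 2 + sqNorm x.2))
        obtain ⟨N, hN⟩ := (ht.eventually_const_lt hc2').exists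
        exact ⟨N, hc1.trans (by exact_mod_cast hN)⟩
      · have hpos := sqNorm_pos hGx
        have h2 := sqNorm_nonneg x.2
        obtain ⟨N, hN⟩ := exists_nat_gt
          (((v x.2).toReal - (h x.1).re + (‖x.1‖ ^ 2 + sqNorm x.2)) / sqNorm (G x))
        refine ⟨N, (EReal.le_coe_toReal (hv.ne_top _)).trans_lt ?_⟩
        rw [div_lt_iff₀ hpos] at hN
        have h3 : (‖x.1‖ ^ 2 + sqNorm x.2) / (N + 1 : ℝ) ≤ ‖x.1‖ ^ 2 + sqNorm x.2 :=
          div_le_self (by positivity) (by linarith [(Nat.cast_nonneg N : (0 : ℝ) ≤ N)])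
        have : (v x.2).toReal < penalty h G N x := by
          unfold penalty; linarith
        exact_mod_cast this
    · refine Monotone.directed_le fun m n hmn x hx => ?_
      have hx' : v x.2 < (penalty h G m x : EReal) := hx
      exact hx'.trans_le (by exact_mod_cast penalty_mono hmn x)
  by_contra! hcon
  have hx₀S : ((0 : ℂ), z₀) ∈ S := by
    rw [hmemS]
    have := hR (0, z₀) (by simp) (by simp [hz₀])
    exact ⟨by simp, by simpa using this.trans (by linarith)⟩
  obtain ⟨x, hxS, hmax⟩ := ((upperSemicontinuous_sub_coe hv2 (hk N)).upperSemicontinuousOn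
    S).exists_isMaxOn ⟨_, hx₀S⟩ hScomp
  have hx₀ : (penalty h G N (0, z₀) : EReal) < v z₀ :=
    lt_of_le_of_lt (by exact_mod_cast penalty_le_of_eq_zero hz₀ N) hcon
  have h1 := hmax hx₀S
  obtain ⟨m, hm⟩ : ∃ m : ℝ, v x.2 = m := by
    refine ⟨(v x.2).toReal, (EReal.coe_toReal (hv.ne_top _) fun hbot => ?_).symm⟩
    simp only [Set.mem_ofPred_eq, hbot, EReal.bot_sub, le_bot_iff] at h1
    rw [sub_eq_add_neg, ← EReal.coe_neg, EReal.add_eq_bot_iff] at h1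
    rcases h1 with h1 | h1
    · exact not_lt_bot (h1 ▸ hx₀)
    · exact EReal.coe_ne_bot _ h1
  have hle : ∀ y ∈ S, v y.2 ≤ ((penalty h G N y + (m - penalty h G N x) : ℝ) : EReal) := by
    intro y hy
    have h2 := hmax hy
    simp only [Set.mem_ofPred_eq, hm] at h2
    rw [← EReal.coe_sub, EReal.sub_le_iff_le_add (by simp) (by simp), ← EReal.coe_add] at h2
    rwa [add_comm (penalty h G N y)]
  -- At `(0, z₀)` the difference is already positive, so its maximum is too, which excludes `B`.
  have hmx : penalty h G N x < m := by
    have h2 := hx₀.trans_le (hle _ hx₀S)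
    have h3 : penalty h G N (0, z₀) < penalty h G N (0, z₀) + (m - penalty h G N x) := by
      exact_mod_cast h2
    linarith
  have hxB : x ∉ B := fun hxB => by
    have h2 : v x.2 < (penalty h G N x : EReal) := hN hxB
    rw [hm] at h2
    have : m < penalty h G N x := by exact_mod_cast h2
    linarith
  obtain ⟨hx1, hx2⟩ := (hmemS x).1 hxS
  have hx1' : ‖x.1‖ < 1 := lt_of_le_of_ne hx1 fun e => hxB ⟨hxS, Or.inl e⟩
  have hx2' : ‖x.2‖ < R + 1 := lt_of_le_of_ne hx2 fun e => hxB ⟨hxS, Or.inr e⟩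
  obtain ⟨y, hy, havg⟩ := exists_circleAverage_penalty_lt hh hG N x
    (δ := min (1 - ‖x.1‖) (R + 1 - ‖x.2‖)) (lt_min (by linarith) (by linarith))
  obtain ⟨hy1, hy2⟩ := lt_min_iff.1 hy
  have hcont : Continuous fun t : ℂ => penalty h G N (x + t • y) :=
    (hk N).comp (by fun_prop)
  -- The shifted majorant dominates `v` on `S` and touches it at `x`; the sub-mean inequality for
  -- `v` then contradicts the strict drop of the majorant's average.
  have h4 : v x.2 ≤ ((Real.circleAverage (fun t : ℂ => penalty h G N (x + t • y) +
      (m - penalty h G N x)) 0 1 : ℝ) : EReal) := by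
    refine (hv.le_circleMean x.2 y.2).trans (circleMean_le_circleAverage (by fun_prop) ?_)
    intro ζ hζ
    refine hle (x + ζ • y) ((hmemS _).2 ⟨?_, ?_⟩)
    · refine (norm_add_le _ _).trans ?_
      have := norm_fst_le y
      rw [Prod.smul_fst, norm_smul, hζ, one_mul]
      linarith
    · refine (norm_add_le _ _).trans ?_
      have := norm_snd_le y
      rw [Prod.smul_snd, norm_smul, hζ, one_mul]
      linarith
  rw [hm, Real.circleAverage_fun_add (ContinuousOn.circleIntegrable' (by fun_prop))
    (circleIntegrable_const _ _ _), Real.circleAverage_const] at h4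
  have h5 : m ≤ Real.circleAverage (fun t : ℂ => penalty h G N (x + t • y)) 0 1 +
    (m - penalty h G N x) := by exact_mod_cast h4
  linarith

/-- Sub-mean value inequality for upper semicontinuous majorants of fibrewise values. -/
theorem IsPSH.le_circleMean_of_zero_set (hv : IsPSH v) {G : ℂ × (Fin d → ℂ) → Fin d → ℂ}
    (hG : Differentiable ℂ G) {R : ℝ} (hR : ∀ x, ‖x.1‖ ≤ 1 → ‖G x‖ ≤ 1 → ‖x.2‖ ≤ R)
    {f : ℂ → EReal} (hf : UpperSemicontinuous f) (htop : ∀ ζ, f ζ ≠ ⊤)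
    (hvf : ∀ x, G x = 0 → v x.2 ≤ f x.1) {z₀ : Fin d → ℂ} (hz₀ : G (0, z₀) = 0) :
    v z₀ ≤ circleMean f :=
  le_circleMean_of_forall_entire hf htop fun _ hh hfh =>
    hv.le_re_of_zero_set hG hR hh (fun x hx hGx => (hvf x hGx).trans_lt (hfh _ hx)) hz₀

end CExtremal

/-! ### Plurisubharmonicity of pullbacks and fibre maxima -/

namespace CExtremal

variable {d : ℕ} {F : (Fin d → ℂ) → Fin d → ℂ}

theorem IsPolynomialMap.differentiable (hF : IsPolynomialMap F) : Differentiable ℂ F := by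
  obtain ⟨P, hP⟩ := hF
  rw [differentiable_pi]
  intro i
  simp_rw [hP]
  induction P i using MvPolynomial.induction_on with
  | C a => simp
  | add p q hp hq => simpa using hp.fun_add hq
  | mul_X p j hp => simpa using hp.fun_mul (differentiable_apply j)

/-- The maximum of a function over the fibres of a map. -/
noncomputable def fibreSup (F : (Fin d → ℂ) → Fin d → ℂ) (v : (Fin d → ℂ) → EReal)
    (w : Fin d → ℂ) : EReal :=
  ⨆ z ∈ F ⁻¹' {w}, v z

theorem le_fibreSup (v : (Fin d → ℂ) → EReal) (z : Fin d → ℂ) : v z ≤ fibreSup F v (F z) :=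
  le_iSup₂ (f := fun z' (_ : z' ∈ F ⁻¹' {F z}) => v z') z rfl

/-- The graph of `ζ ↦ F (a + ζ • b)` serves as the zero set. -/
theorem IsPSH.comp {u : (Fin d → ℂ) → EReal} (hu : IsPSH u) (hF : Differentiable ℂ F) :
    IsPSH fun z => u (F z) where
  ne_top z := hu.ne_top _
  usc := hu.usc.comp hF.continuous
  le_circleMean a b := by
    have hFc := hF.continuous
    have hc : Continuous fun ζ : ℂ => F (a + ζ • b) := by fun_prop
    obtain ⟨A, hA⟩ := (isCompact_closedBall (0 : ℂ) 1).exists_bound_of_continuousOn hc.continuousOn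
    refine hu.le_circleMean_of_zero_set (G := fun x => x.2 - F (a + x.1 • b)) (R := A + 1)
      (by fun_prop) ?_ (hu.usc.comp hc) (fun _ => hu.ne_top _) ?_ (by simp)
    · intro x hx hG
      have h1 := hA x.1 (by simpa using hx)
      have h2 := norm_sub_norm_le x.2 (F (a + x.1 • b))
      linarith
    · intro x hx
      exact (congrArg u (sub_eq_zero.1 hx)).le

/-- Fibres are compact, so a nonempty one attains its supremum and strictness survives; `⊥ < c`
accounts for empty fibres. -/
theorem fibreSup_lt_iff (hF : IsProperMap F) {v : (Fin d → ℂ) → EReal}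
    (hv : UpperSemicontinuous v) {w : Fin d → ℂ} {c : EReal} (hc : ⊥ < c) :
    fibreSup F v w < c ↔ ∀ z, F z = w → v z < c := by
  constructor
  · rintro h z rfl
    exact (le_fibreSup v z).trans_lt h
  · intro h
    by_cases hne : (F ⁻¹' {w}).Nonempty
    · obtain ⟨z, hz, hmax⟩ := (hv.upperSemicontinuousOn (F ⁻¹' {w})).exists_isMaxOn hne
        (hF.isCompact_preimage isCompact_singleton)
      exact (iSup₂_le fun z' hz' => hmax hz').trans_lt (h z hz)
    · rw [Set.not_nonempty_iff_eq_empty] at hne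
      simpa [fibreSup, hne] using hc

/-- The set where the fibre maximum is at least `c > ⊥` is the image of the closed set `{v ≥ c}`,
and proper maps are closed. -/
theorem upperSemicontinuous_fibreSup (hF : IsProperMap F) {v : (Fin d → ℂ) → EReal}
    (hv : UpperSemicontinuous v) : UpperSemicontinuous (fibreSup F v) := by
  rw [upperSemicontinuous_iff_isOpen_preimage]
  intro c
  rcases eq_bot_or_bot_lt c with rfl | hc
  · simp
  have : fibreSup F v ⁻¹' Set.Iio c = (F '' (v ⁻¹' Set.Iio c)ᶜ)ᶜ := by
    ext w
    simp only [Set.mem_preimage, Set.mem_Iio, fibreSup_lt_iff hF hv hc, Set.mem_compl_iff,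
      Set.mem_image, not_exists, not_and, not_lt]
    constructor
    · intro h z hz hzw
      exact absurd (h z hzw) (not_lt.2 hz)
    · intro h z hzw
      by_contra hz
      exact h z (not_lt.1 hz) hzw
  rw [this, isOpen_compl_iff]
  exact hF.isClosedMap _ (hv.isOpen_preimage c).isClosed_compl

/-- The zero set is the preimage under `F` of a complex line, bounded over the disc by properness.
Each `z₀` over `a` gives the inequality, and the supremum over `z₀` follows. -/
theorem IsPSH.fibreSup {v : (Fin d → ℂ) → EReal} (hv : IsPSH v) (hF : Differentiable ℂ F)
    (hFp : IsProperMap F) : IsPSH (fibreSup F v) where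
  ne_top w := ((fibreSup_lt_iff hFp hv.usc bot_lt_top).2 fun z _ => (hv.ne_top z).lt_top).ne
  usc := upperSemicontinuous_fibreSup hFp hv.usc
  le_circleMean a b := by
    have husc := upperSemicontinuous_fibreSup hFp hv.usc
    obtain ⟨R, hR⟩ := (hFp.isCompact_preimage
      (isCompact_closedBall (0 : Fin d → ℂ) (‖a‖ + ‖b‖ + 1))).isBounded.exists_norm_le
    refine iSup₂_le fun z₀ hz₀ => ?_
    refine hv.le_circleMean_of_zero_set (G := fun x => F x.2 - (a + x.1 • b)) (R := R)
      (by fun_prop) ?_ (husc.comp (by fun_prop : Continuous fun ζ : ℂ => a + ζ • b))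
      (fun ζ => ((fibreSup_lt_iff hFp hv.usc bot_lt_top).2 fun z _ => (hv.ne_top z).lt_top).ne)
      ?_ (z₀ := z₀) ?_
    · intro x hx hG
      refine hR x.2 ?_
      rw [Set.mem_preimage, mem_closedBall_zero_iff]
      have h1 := norm_sub_norm_le (F x.2) (a + x.1 • b)
      have h2 := norm_add_le a (x.1 • b)
      rw [norm_smul] at h2
      have h3 : ‖x.1‖ * ‖b‖ ≤ 1 * ‖b‖ := by gcongr
      linarith
    · intro x hx
      change v x.2 ≤ CExtremal.fibreSup F v (a + x.1 • b)
      rw [← sub_eq_zero.1 hx]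
      exact le_fibreSup v x.2
    · have : F z₀ = a := hz₀
      simp [this]

/-! ### Growth at infinity and the classes `L_C`, `L_{C'}` -/

theorem logIndicator_eq_log (C : Set (Fin d → ℝ)) (z : Fin d → ℂ) :
    logIndicator C z = ENNReal.log (supMonomial C z) := by
  have := ENNReal.logOrderIso.map_iSup₂ (fun (J : Fin d → ℝ) (_ : J ∈ C) => absMonomial J z)
  exact this.symm

theorem logIndicator_le_add {C C' : Set (Fin d → ℝ)} {z w : Fin d → ℂ} {M : ℝ} (hM : 0 < M)
    (h : supMonomial C z ≤ ENNReal.ofReal M * supMonomial C' w) :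
    logIndicator C z ≤ logIndicator C' w + (Real.log M : EReal) := by
  rw [logIndicator_eq_log, logIndicator_eq_log, add_comm, ← ENNReal.log_ofReal_of_pos hM,
    ← ENNReal.log_mul_add]
  exact ENNReal.log_le_log h

variable {C C' : Set (Fin d → ℝ)}

theorem exists_eventually_logIndicator_comp_le
    (hlimsup : Filter.limsup (fun z => supMonomial C (F z) / supMonomial C' z)
      (cobounded (Fin d → ℂ)) < ⊤) :
    ∃ c : ℝ, ∀ᶠ z in cobounded (Fin d → ℂ),
      logIndicator C (F z) ≤ logIndicator C' z + (c : EReal) := by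
  obtain ⟨M, hM, hMt⟩ := exists_between hlimsup
  have hM0 : M ≠ 0 := (bot_le.trans_lt hM).ne'
  refine ⟨Real.log M.toReal, (eventually_lt_of_limsup_lt hM).mono fun z hz => ?_⟩
  refine logIndicator_le_add (ENNReal.toReal_pos hM0 hMt.ne) ?_
  rw [ENNReal.ofReal_toReal hMt.ne]
  exact (ENNReal.div_le_iff_le_mul (Or.inr hMt.ne) (Or.inr hM0)).1 hz.le

theorem exists_eventually_logIndicator_le_comp
    (hliminf : 0 < Filter.liminf (fun z => supMonomial C (F z) / supMonomial C' z)
      (cobounded (Fin d → ℂ))) :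
    ∃ c : ℝ, ∀ᶠ z in cobounded (Fin d → ℂ),
      logIndicator C' z ≤ logIndicator C (F z) + (c : EReal) := by
  obtain ⟨ε, hε, hεl⟩ := exists_between hliminf
  have hεt : ε ≠ ⊤ := (hεl.trans_le le_top).ne
  refine ⟨Real.log ε⁻¹.toReal, (eventually_lt_of_lt_liminf hεl).mono fun z hz => ?_⟩
  refine logIndicator_le_add (ENNReal.toReal_pos (by simpa) (by simpa using hε.ne')) ?_
  rw [ENNReal.ofReal_toReal (by simpa using hε.ne'), mul_comm, ← div_eq_mul_inv,
    ENNReal.le_div_iff_mul_le (Or.inl hε.ne') (Or.inl hεt)]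
  exact ENNReal.mul_le_of_le_div' hz.le

theorem comp_mem_lelongClass (hF : Differentiable ℂ F) (hFp : IsProperMap F)
    (hlimsup : Filter.limsup (fun z => supMonomial C (F z) / supMonomial C' z)
      (cobounded (Fin d → ℂ)) < ⊤) {u : (Fin d → ℂ) → EReal} (hu : u ∈ lelongClass C) :
    (fun z => u (F z)) ∈ lelongClass C' := by
  obtain ⟨hpsh, c, hc⟩ := hu
  obtain ⟨c', hc'⟩ := exists_eventually_logIndicator_comp_le hlimsup
  refine ⟨hpsh.comp hF, c' + c, ?_⟩
  have ht : Tendsto F (cobounded _) (cobounded _) := by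
    rw [Metric.cobounded_eq_cocompact]
    exact (isProperMap_iff_tendsto_cocompact.1 hFp).2
  filter_upwards [ht.eventually hc, hc'] with z h1 h2
  refine h1.trans ?_
  rw [EReal.coe_add, ← add_assoc]
  gcongr

theorem fibreSup_mem_lelongClass (hF : Differentiable ℂ F) (hFp : IsProperMap F)
    (hliminf : 0 < Filter.liminf (fun z => supMonomial C (F z) / supMonomial C' z)
      (cobounded (Fin d → ℂ))) {v : (Fin d → ℂ) → EReal} (hv : v ∈ lelongClass C') :
    fibreSup F v ∈ lelongClass C := by
  obtain ⟨hpsh, c, hc⟩ := hv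
  obtain ⟨c', hc'⟩ := exists_eventually_logIndicator_le_comp hliminf
  refine ⟨hpsh.fibreSup hF hFp, c' + c, ?_⟩
  have hev := hc.and hc'
  rw [Metric.cobounded_eq_cocompact] at hev
  obtain ⟨T, hT, hTc⟩ := mem_cocompact.1 hev
  -- For `w` outside the compact set `F(T)`, every preimage lies outside `T`, so the growth bounds
  -- hold on the whole fibre at once.
  have := (hT.image hF.continuous).compl_mem_cocompact
  rw [← Metric.cobounded_eq_cocompact] at this
  filter_upwards [this] with w hw
  refine iSup₂_le fun z hz => ?_
  have hzw : F z = w := hz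
  obtain ⟨h1, h2⟩ := hTc (fun hzT => hw ⟨z, hzT, hzw⟩ : z ∈ Tᶜ)
  rw [hzw] at h2
  refine h1.trans ?_
  rw [EReal.coe_add, ← add_assoc]
  gcongr

end CExtremal

/-! ### Equality of the extremal functions -/

theorem mainTheorem3 (d : ℕ) (hd : 1 ≤ d) (C C' : Set (Fin d → ℝ))
    (hC : CExtremal.IsConvexBody C) (hC' : CExtremal.IsConvexBody C')
    (hCnonneg : ∀ J ∈ C, ∀ i, 0 ≤ J i) (hCnonneg' : ∀ J ∈ C', ∀ i, 0 ≤ J i)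
    (hCsimplex : ∃ k : ℕ, 0 < k ∧
      CExtremal.simplex d ⊆ (fun J : Fin d → ℝ => (k : ℝ) • J) '' C)
    (hCsimplex' : ∃ k : ℕ, 0 < k ∧
      CExtremal.simplex d ⊆ (fun J : Fin d → ℝ => (k : ℝ) • J) '' C')
    (F : (Fin d → ℂ) → (Fin d → ℂ)) (hFpoly : CExtremal.IsPolynomialMap F)
    (hFproper : IsProperMap F)
    (hliminf : 0 < Filter.liminf
      (fun z => CExtremal.supMonomial C (F z) / CExtremal.supMonomial C' z)
      (Bornology.cobounded (Fin d → ℂ)))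
    (hlimsup : Filter.limsup
      (fun z => CExtremal.supMonomial C (F z) / CExtremal.supMonomial C' z)
      (Bornology.cobounded (Fin d → ℂ)) < ⊤)
    (K : Set (Fin d → ℂ)) (hK : IsCompact K) (z : Fin d → ℂ) :
    CExtremal.extremal C K (F z) = CExtremal.extremal C' (F ⁻¹' K) z := by
  have hF := hFpoly.differentiable
  refine le_antisymm (iSup₂_le ?_) (iSup₂_le ?_)
  · rintro u ⟨hu, huK⟩
    exact le_iSup₂_of_le (fun z => u (F z))
      ⟨CExtremal.comp_mem_lelongClass hF hFproper hlimsup hu, fun w hw => huK _ hw⟩ le_rfl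
  · rintro v ⟨hv, hvK⟩
    refine le_iSup₂_of_le (CExtremal.fibreSup F v)
      ⟨CExtremal.fibreSup_mem_lelongClass hF hFproper hliminf hv, fun w hw => ?_⟩
      (CExtremal.le_fibreSup v z)
    refine iSup₂_le fun z' hz' => hvK z' ?_
    have : F z' = w := hz'
    simpa [this] using hw
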